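/- Let $n\ge 2$. If $E\subset\mathbb R^n$ is closed, totally disconnected, and has finite $(n-1)$-dimensional Hausdorff measure, $\mathcal H^{n-1}(E)<\infty$, then $E$ is metrically removable. That is, for every $\epsilon>0$, any two points $a,b\in\mathbb R^n$ can be connected by a curve that is disjoint from $E\setminus\{a,b\}$ and has length at most $|a-b|+\epsilon$. Here $|\cdot|$ is the Euclidean norm, a curve is a continuous map $\gamma\colon[\alpha,\beta]\to\mathbb R^n$ (with $\gamma(\alpha)=a$ and $\gamma(\beta)=b$), and its length is the supremum of the sums $\sum_j|\gamma(t_j)-\gamma(t_{j-1})|$ over all finite partitions of $[\alpha,\beta]$. -/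

import Mathlib

open scoped ENNReal MeasureTheory

/-- The length of the curve `γ : [α, β] → X` (the restriction to `[α, β]` of a map defined on `ℝ`):
the supremum of `∑ d(γ(t_j), γ(t_{j-1}))` over all finite partitions of `[α, β]`. It may be `∞`. -/
noncomputable def curveLength {X : Type*} [MetricSpace X] (γ : ℝ → X) (α β : ℝ) : ℝ≥0∞ :=
  eVariationOn γ (Set.Icc α β)

/-- A set `E` in a metric space `X` is metrically removable if for every `ε > 0`, any two points
`a, b` of `X` can be connected by a curve (a continuous map on some compact interval `[α, β]`)
that is disjoint from `E \ {a, b}` and has length at most `d(a, b) + ε`. -/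
def MetricallyRemovable {X : Type*} [MetricSpace X] (E : Set X) : Prop :=
  ∀ ε : ℝ, 0 < ε → ∀ a b : X, ∃ (α β : ℝ) (γ : ℝ → X), α ≤ β ∧
    ContinuousOn γ (Set.Icc α β) ∧ γ α = a ∧ γ β = b ∧
    Disjoint (γ '' Set.Icc α β) (E \ {a, b}) ∧
    curveLength γ α β ≤ ENNReal.ofReal (dist a b + ε)

/-!
A path is built off `E` that is hardly longer than the segment from `a` to `b`.

*Reduction to the plane.* By Eilenberg's slicing inequality
(`ae_hausdorffMeasure_one_fiber_lt_top`), almost every plane parallel to `b - a` meets `E` in a set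
of finite length. Endpoints off `E` can be moved slightly to such a plane (`joinedWithin_compl`),
and within it to a line that meets `E` in a null set for `μH[1]`, since only countably many parallel
lines do not (`joinedWithin_compl_complex`).

*The plane.* Let the segment `S` meet the closed totally disconnected set `E ⊆ ℂ` in a null set. A
compact, relatively open part `K` of `E` contains `E ∩ S` and lies in a thin rectangle around `S`,
so its length is small. Cover `K` by a finite union `U` of small discs whose radii have a small sum
and whose frontier avoids `E`. Let `O` be the component of `Uᶜ` that contains the endpoints. The
plane is unicoherent: the endpoints are not separated in `frontier O ∪ (S ∩ O)`
(`false_of_separated_frontier`). The proof takes a Urysohn function `φ` for a supposed separation,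
regards it modulo `1` as a map to the circle which is `0` on `O`, and lifts this map to `ℝ`.
The set `frontier O ∪ (S ∩ O)` is covered by short pieces of `S` and by small discs along the
circles that bound `U`, all of them convex and off `E`, with sum of diameters at most `|S| + ε`. A
chain of these pieces leads from one endpoint to the other (`joinedWithin_of_finite_cover`), and
this gives `joinedWithin_compl_of_segment_null`.

*Endpoints in `E`.* A point of `E` is the limit of points off `E` that converge to it at a geometric
rate; the curves between consecutive ones are concatenated (`JoinedWithin.of_tendsto`).
-/

open Set Filter Topology

/-! ### Curves of bounded length -/

/-- `JoinedWithin D x y ℓ` : the points `x` and `y` are joined by a curve inside `D` of length at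
most `ℓ`. The parameter interval is arbitrary; see `JoinedWithin.exists_on`. -/
def JoinedWithin {X : Type*} [MetricSpace X] (D : Set X) (x y : X) (ℓ : ℝ≥0∞) : Prop :=
  ∃ (α β : ℝ) (γ : ℝ → X), α ≤ β ∧ ContinuousOn γ (Icc α β) ∧ γ α = x ∧ γ β = y ∧
    MapsTo γ (Icc α β) D ∧ eVariationOn γ (Icc α β) ≤ ℓ

namespace JoinedWithin

variable {X : Type*} [MetricSpace X] {D D' : Set X} {x y z : X} {ℓ ℓ' : ℝ≥0∞}

theorem mono (h : JoinedWithin D x y ℓ) (hD : D ⊆ D') (hl : ℓ ≤ ℓ') : JoinedWithin D' x y ℓ' := by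
  obtain ⟨α, β, γ, h1, h2, h3, h4, h5, h6⟩ := h
  exact ⟨α, β, γ, h1, h2, h3, h4, h5.mono_right hD, h6.trans hl⟩

theorem refl (hx : x ∈ D) : JoinedWithin D x x ℓ :=
  ⟨0, 0, fun _ => x, le_rfl, continuousOn_const, rfl, rfl, fun _ _ => hx, by
    rw [eVariationOn.subsingleton _ (by simp)]; exact zero_le⟩

theorem symm (h : JoinedWithin D x y ℓ) : JoinedWithin D y x ℓ := by
  obtain ⟨α, β, γ, h1, h2, h3, h4, h5, h6⟩ := h
  have hm : MapsTo (fun t : ℝ => -t) (Icc (-β) (-α)) (Icc α β) := fun t ht =>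
    ⟨by linarith [ht.2], by linarith [ht.1]⟩
  refine ⟨-β, -α, fun t => γ (-t), by linarith, h2.comp (by fun_prop) hm, by simpa, by simpa,
    fun t ht => h5 (hm ht), le_trans ?_ h6⟩
  exact eVariationOn.comp_le_of_antitoneOn γ (fun t : ℝ => -t) (fun a _ b _ hab => by simpa) hm

/-- The parameter interval of a curve can be prescribed. -/
theorem exists_on (h : JoinedWithin D x y ℓ) {a b : ℝ} (hab : a < b) :
    ∃ γ : ℝ → X, ContinuousOn γ (Icc a b) ∧ γ a = x ∧ γ b = y ∧ MapsTo γ (Icc a b) D ∧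
      eVariationOn γ (Icc a b) ≤ ℓ := by
  obtain ⟨α, β, γ, h1, h2, h3, h4, h5, h6⟩ := h
  have hba : 0 < b - a := sub_pos.2 hab
  have hβ : 0 ≤ β - α := sub_nonneg.2 h1
  set φ : ℝ → ℝ := fun t => α + (t - a) / (b - a) * (β - α) with hφ
  have hmono : Monotone φ := fun s t hst => by
    simp only [hφ]; gcongr
  have ha : φ a = α := by simp [hφ]
  have hb : φ b = β := by simp [hφ, div_self hba.ne']
  have hm : MapsTo φ (Icc a b) (Icc α β) := fun t ht =>
    ⟨ha ▸ hmono ht.1, hb ▸ hmono ht.2⟩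
  exact ⟨γ ∘ φ, h2.comp (by fun_prop) hm, by simp [ha, h3], by simp [hb, h4],
    fun t ht => h5 (hm ht),
    (eVariationOn.comp_le_of_monotoneOn γ φ (hmono.monotoneOn _) hm).trans h6⟩

theorem trans (h : JoinedWithin D x y ℓ) (h' : JoinedWithin D y z ℓ') :
    JoinedWithin D x z (ℓ + ℓ') := by
  obtain ⟨γ, h2, h3, h4, h5, h6⟩ := h.exists_on zero_lt_one
  obtain ⟨δ, k2, k3, k4, k5, k6⟩ := h'.exists_on one_lt_two
  set g : ℝ → X := fun t => if t ≤ 1 then γ t else δ t with hg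
  have e1 : EqOn g γ (Icc 0 1) := fun t ht => by simp [hg, ht.2]
  have e2 : EqOn g δ (Icc 1 2) := fun t ht => by
    rcases eq_or_lt_of_le ht.1 with h | h
    · subst h; simp [hg, h4, k3]
    · simp [hg, not_le.2 h]
  have hU : Icc (0 : ℝ) 2 = Icc 0 1 ∪ Icc 1 2 :=
    (Icc_union_Icc_eq_Icc zero_le_one one_le_two).symm
  refine ⟨0, 2, g, by norm_num, ?_, by simp [hg, h3], ?_, ?_, ?_⟩
  · rw [hU]
    exact (h2.congr e1).union_of_isClosed (k2.congr e2) isClosed_Icc isClosed_Icc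
  · rw [e2 (by simp), k4]
  · rw [hU]
    exact (h5.congr e1.symm).union (k5.congr e2.symm)
  · have := eVariationOn.Icc_add_Icc g (s := univ) zero_le_one one_le_two (mem_univ _)
    simp only [univ_inter] at this
    rw [← this, eVariationOn.congr e1, eVariationOn.congr e2]
    exact add_le_add h6 k6

/-- Countably many curves of finite total length, the `k`-th one leading from `x k` to `x (k + 1)`,
can be concatenated, and the limit of the points `x k` can be added as an endpoint. -/
theorem of_tendsto {x : ℕ → X} {a : X} {ℓ : ℕ → ℝ≥0∞} (hx : Tendsto x atTop (𝓝 a)) (ha : a ∈ D)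
    (hℓ : ∑' k, ℓ k ≠ ∞) (h : ∀ k, JoinedWithin D (x k) (x (k + 1)) (ℓ k)) :
    JoinedWithin D (x 0) a (∑' k, ℓ k) := by
  choose c hc h0 h1 hD hv using fun k : ℕ => (h k).exists_on (lt_add_one (k : ℝ))
  -- The concatenation lives on `[0, ∞)`, which is then compressed to `[0, 1)` by `φ`.
  set g : ℝ → X := fun t => c ⌊t⌋₊ t with hg
  have heq : ∀ k : ℕ, EqOn g (c k) (Icc k (k + 1)) := fun k t ht => by
    rcases eq_or_lt_of_le ht.2 with h | h
    · have : ⌊t⌋₊ = k + 1 := by rw [h]; exact_mod_cast Nat.floor_natCast (k + 1)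
      simp only [hg, this]
      have := h0 (k + 1)
      push_cast at this
      rw [h, this, h1]
    · have : ⌊t⌋₊ = k := (Nat.floor_eq_iff (k.cast_nonneg.trans ht.1)).2 ⟨ht.1, h⟩
      simp only [hg, this]
  have hmem : ∀ t : ℝ, 0 ≤ t → t ∈ Icc (⌊t⌋₊ : ℝ) (⌊t⌋₊ + 1) := fun t ht =>
    ⟨Nat.floor_le ht, (Nat.lt_floor_add_one t).le⟩
  have hgD : MapsTo g (Ici 0) D := fun t ht => hD _ (hmem t ht)
  have hcont : ∀ N : ℕ, ContinuousOn g (Icc 0 N) := by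
    intro N
    induction N with
    | zero => simp
    | succ N ih =>
      have : Icc (0 : ℝ) ((N + 1 : ℕ) : ℝ) = Icc 0 (N : ℝ) ∪ Icc N (N + 1) := by
        push_cast
        exact (Icc_union_Icc_eq_Icc N.cast_nonneg (by linarith)).symm
      rw [this]
      exact ih.union_of_isClosed ((hc N).congr (heq N)) isClosed_Icc isClosed_Icc
  have hvar : ∀ N : ℕ, eVariationOn g (Icc 0 N) ≤ ∑ k ∈ Finset.range N, ℓ k := by
    intro N
    induction N with
    | zero => rw [eVariationOn.subsingleton _ (by simp)]; exact zero_le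
    | succ N ih =>
      have := eVariationOn.Icc_add_Icc g (s := univ) (N.cast_nonneg : (0 : ℝ) ≤ N)
        (lt_add_one (N : ℝ)).le (mem_univ _)
      simp only [univ_inter] at this
      push_cast
      rw [← this, Finset.sum_range_succ, eVariationOn.congr (heq N)]
      exact add_le_add ih (hv N)
  have htend : Tendsto g atTop (𝓝 a) := by
    have h2 : Tendsto (fun t : ℝ => x ⌊t⌋₊) atTop (𝓝 a) := hx.comp tendsto_nat_floor_atTop
    have h3 : Tendsto (fun t : ℝ => ℓ ⌊t⌋₊) atTop (𝓝 0) :=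
      (ENNReal.tendsto_atTop_zero_of_tsum_ne_top hℓ).comp tendsto_nat_floor_atTop
    refine (tendsto_iff_edist_tendsto_0.2 ?_)
    have h4 := h3.add (tendsto_iff_edist_tendsto_0.1 h2)
    rw [add_zero] at h4
    refine tendsto_of_tendsto_of_tendsto_of_le_of_le' tendsto_const_nhds h4
      (Eventually.of_forall fun _ => zero_le) ?_
    filter_upwards [eventually_ge_atTop 0] with t ht
    refine (edist_triangle _ (x ⌊t⌋₊) _).trans (add_le_add ?_ le_rfl)
    rw [← h0]
    exact (eVariationOn.edist_le _ (hmem t ht) ⟨le_rfl, by linarith⟩).trans (hv _)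
  set φ : ℝ → ℝ := fun s => s / (1 - s) with hφ
  have hφm : MonotoneOn φ (Iio 1) := fun s hs t ht hst => by
    have h1 : 0 < 1 - s := sub_pos.2 hs
    have h2 : 0 < 1 - t := sub_pos.2 ht
    simp only [hφ]
    rw [div_le_div_iff₀ h1 h2]
    nlinarith
  have hφc : ContinuousOn φ (Iio 1) := fun s hs =>
    (continuousAt_id.div (by fun_prop) (sub_pos.2 hs).ne').continuousWithinAt
  have hφ0 : ∀ s ∈ Ico (0 : ℝ) 1, 0 ≤ φ s := fun s hs => div_nonneg hs.1 (sub_pos.2 hs.2).le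
  have hφt : Tendsto φ (𝓝[<] 1) atTop := by
    have h2 : Tendsto (fun s : ℝ => 1 - s) (𝓝[<] 1) (𝓝[>] 0) := by
      refine tendsto_nhdsWithin_iff.2 ⟨?_, ?_⟩
      · have : Tendsto (fun s : ℝ => 1 - s) (𝓝 1) (𝓝 (1 - 1)) :=
          (continuous_const.sub continuous_id).tendsto _
        rw [sub_self] at this
        exact this.mono_left nhdsWithin_le_nhds
      · filter_upwards [self_mem_nhdsWithin] with s hs using sub_pos.2 (mem_Iio.1 hs)
    have h3 : Tendsto (fun s : ℝ => s) (𝓝[<] 1) (𝓝 1) := tendsto_id.mono_left nhdsWithin_le_nhds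
    exact Tendsto.pos_mul_atTop zero_lt_one h3 (tendsto_inv_nhdsGT_zero.comp h2)
  set G : ℝ → X := fun s => if s < 1 then g (φ s) else a with hG
  have hG1 : ContinuousWithinAt G (Iic 1) 1 := by
    have : Tendsto G (𝓝[<] 1) (𝓝 (G 1)) := by
      rw [show G 1 = a by simp [hG]]
      refine (htend.comp hφt).congr' ?_
      filter_upwards [self_mem_nhdsWithin] with s hs
      simp [hG, mem_Iio.1 hs]
    exact continuousWithinAt_Iio_iff_Iic.1 this
  have hGc : ContinuousOn G (Icc 0 1) := by
    intro s hs
    rcases eq_or_lt_of_le hs.2 with h | h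
    · subst h
      exact hG1.mono fun t ht => ht.2
    · obtain ⟨N, hN⟩ := exists_nat_gt (φ s)
      have hev : ∀ᶠ t in 𝓝[Icc 0 1] s, φ t ∈ Icc (0 : ℝ) N ∧ t < 1 := by
        have h4 : ContinuousAt φ s := hφc.continuousAt (Iio_mem_nhds h)
        filter_upwards [self_mem_nhdsWithin, nhdsWithin_le_nhds (Iio_mem_nhds h),
          nhdsWithin_le_nhds (h4.eventually (gt_mem_nhds hN))] with t ht ht1 ht2
        exact ⟨⟨hφ0 t ⟨ht.1, ht1⟩, le_of_lt ht2⟩, ht1⟩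
      have h5 : Tendsto φ (𝓝[Icc 0 1] s) (𝓝[Icc (0 : ℝ) N] (φ s)) :=
        tendsto_nhdsWithin_iff.2 ⟨(hφc.continuousAt (Iio_mem_nhds h)).tendsto.mono_left
          nhdsWithin_le_nhds, hev.mono fun t ht => ht.1⟩
      have h6 := (hcont N (φ s) ⟨hφ0 s ⟨hs.1, h⟩, hN.le⟩).tendsto.comp h5
      have : Tendsto G (𝓝[Icc 0 1] s) (𝓝 (G s)) := by
        rw [show G s = g (φ s) by simp [hG, h]]
        exact h6.congr' (hev.mono fun t ht => by simp [hG, ht.2])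
      exact this
  refine ⟨0, 1, G, zero_le_one, hGc, ?_, by simp [hG], ?_, ?_⟩
  · have := (heq 0) (show (0 : ℝ) ∈ _ by simp)
    have h00 := h0 0
    push_cast at h00
    simp [hG, hφ, this, h00]
  · intro s hs
    simp only [hG]
    split_ifs with h
    · exact hgD (hφ0 s ⟨hs.1, h⟩)
    · exact ha
  · have h1 : eVariationOn G (Ico 0 1) ≤ ∑' k, ℓ k := by
      have e : EqOn G (g ∘ φ) (Ico 0 1) := fun s hs => by simp [hG, hs.2]
      rw [eVariationOn.congr e]
      refine (eVariationOn.comp_le_of_monotoneOn g φ (hφm.mono fun s hs => hs.2)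
        (t := Ico 0 1) (s := Ici 0) hφ0).trans ?_
      rw [eVariationOn.eq_biSup_inter_Icc]
      simp only [iSup_le_iff]
      intro p hp 
      obtain ⟨N, hN⟩ := exists_nat_gt p.2
      refine (eVariationOn.mono g (s := Icc 0 N) ?_).trans ((hvar N).trans (ENNReal.sum_le_tsum _))
      intro t ht
      exact ⟨ht.1, ht.2.2.trans hN.le⟩
    rw [← eVariationOn.eVariationOn_Ico_eq_Icc_of_continuousWithinAt hG1]
    exact h1

end JoinedWithin

/-- In a convex set, two points are joined by a segment. -/
theorem Convex.joinedWithin {V : Type*} [NormedAddCommGroup V] [NormedSpace ℝ V] {D : Set V}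
    (hD : Convex ℝ D) {x y : V} (hx : x ∈ D) (hy : y ∈ D) :
    JoinedWithin D x y (edist x y) := by
  refine ⟨0, 1, AffineMap.lineMap x y, zero_le_one,
    AffineMap.lineMap_continuous.continuousOn, by simp, by simp, ?_, ?_⟩
  · intro t ht
    exact hD.lineMap_mem hx hy ht
  · have hl : LipschitzOnWith (nndist x y) (AffineMap.lineMap (k := ℝ) x y) (Icc 0 1) :=
      (lipschitzWith_lineMap x y).lipschitzOnWith
    have h1 := hl.comp_eVariationOn_le (mapsTo_id (Icc (0 : ℝ) 1))
    have h2 : eVariationOn (id : ℝ → ℝ) (Icc 0 1) ≤ 1 := by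
      have := (monotone_id.monotoneOn (Icc (0 : ℝ) 1)).eVariationOn_eq
        (show (0 : ℝ) ∈ Icc (0 : ℝ) 1 by simp) (show (1 : ℝ) ∈ Icc (0 : ℝ) 1 by simp)
      rw [inter_self] at this
      simp [this]
    calc _ ≤ (nndist x y : ℝ≥0∞) * eVariationOn (id : ℝ → ℝ) (Icc 0 1) := h1
      _ ≤ (nndist x y : ℝ≥0∞) * 1 := by gcongr
      _ = edist x y := by rw [mul_one, edist_nndist]

/-! ### Unicoherence of the plane and chains of sets -/

/-- **Unicoherence of the plane**, in the form in which it produces curves around obstacles.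
Let `O` be connected, and let the connected set `S` meet `O` in `a` and `b`. Then
`frontier O ∪ (S ∩ O)` is not the union of two disjoint closed sets that separate `a` from `b`. -/
theorem false_of_separated_frontier {O S T₁ T₂ : Set ℂ} (hOc : IsPreconnected O)
    (hS : IsPreconnected S) (h₁ : IsClosed T₁) (h₂ : IsClosed T₂) (hd : Disjoint T₁ T₂)
    (hfr : frontier O ⊆ T₁ ∪ T₂) (hSO : S ∩ O ⊆ T₁ ∪ T₂) {a b : ℂ} (haS : a ∈ S) (hbS : b ∈ S)
    (haO : a ∈ O) (hbO : b ∈ O) (ha : a ∈ T₁) (hb : b ∈ T₂) : False := by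
  classical
  obtain ⟨φ, hφ1, hφ2, -⟩ := exists_continuous_zero_one_of_isClosed h₁ h₂ hd
  have hφT : ∀ z ∈ T₁ ∪ T₂, ((φ z : ℝ) : AddCircle (1 : ℝ)) = 0 := by
    rintro z (hz | hz)
    · rw [hφ1 hz]; simp
    · rw [hφ2 hz]; exact AddCircle.coe_period 1
  -- This is continuous, because `φ` is `0` or `1` on the frontier of `O`.
  set f : ℂ → AddCircle (1 : ℝ) := fun z => if z ∈ O then 0 else ((φ z : ℝ) : AddCircle (1 : ℝ))
    with hf
  have hfc : Continuous f := by
    refine Continuous.if (fun z hz => ?_) continuous_const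
      ((AddCircle.continuous_mk' 1).comp φ.continuous)
    exact (hφT z (hfr hz)).symm
  obtain ⟨a', ha'⟩ : ∃ r : ℝ, (r : AddCircle (1 : ℝ)) = f a := ⟨0, by simp [hf, haO]⟩
  obtain ⟨θ, ⟨-, hθ⟩, -⟩ := (AddCircle.isCoveringMap_coe (1 : ℝ)).existsUnique_continuousMap_lifts
    ⟨f, hfc⟩ a a' ha'
  have hθf : ∀ z, ((θ z : ℝ) : AddCircle (1 : ℝ)) = f z := fun z => congrFun hθ z
  -- A continuous real function with values in `ℤ` is constant on connected sets.
  have key : ∀ (A : Set ℂ) (g : ℂ → ℝ), IsPreconnected A → Continuous g →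
      (∀ z ∈ A, ((g z : ℝ) : AddCircle (1 : ℝ)) = 0) → ∀ x ∈ A, ∀ y ∈ A, g x = g y := by
    intro A g hA hg hz x hx y hy
    have hi : ∀ z ∈ A, g z ∈ range ((↑) : ℤ → ℝ) := fun z h => by
      obtain ⟨n, hn⟩ := (AddCircle.coe_eq_zero_iff 1).1 (hz z h)
      exact ⟨n, by simpa using hn⟩
    have hpre : IsPreconnected (g '' A) := hA.image g hg.continuousOn
    have hsub : (g '' A).Subsingleton := by
      have hcd : IsTotallyDisconnected (range ((↑) : ℤ → ℝ)) :=
        (countable_range _).isTotallyDisconnected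
      exact hcd _ (by rintro _ ⟨z, h, rfl⟩; exact hi z h) hpre
    exact hsub (mem_image_of_mem g hx) (mem_image_of_mem g hy)
  have h1 : θ a = θ b := key O θ hOc θ.continuous
    (fun z hz => by rw [hθf]; simp [hf, hz]) a haO b hbO
  -- Off `O` both `φ` and `θ` represent `f`; on `S ∩ O` both are integers.
  have h2 : φ a - θ a = φ b - θ b := by
    refine key S (fun z => φ z - θ z) hS (φ.continuous.sub θ.continuous) (fun z hz => ?_)
      a haS b hbS
    rw [AddCircle.coe_sub, hθf]
    by_cases h : z ∈ O
    · rw [hφT z (hSO ⟨hz, h⟩)]; simp [hf, h]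
    · simp [hf, h]
  rw [hφ1 ha, hφ2 hb] at h2
  simp only [h1, Pi.zero_apply, Pi.one_apply] at h2
  linarith

/-- If a finite family of closed sets covers `T` and its members are cheaply joined, then two
points of `T` that are not separated in `T` are joined at the total cost of the family. -/
theorem joinedWithin_of_finite_cover {X : Type*} [MetricSpace X] {ι : Type*} [Fintype ι]
    {D T : Set X} {A : ι → Set X} {ℓ : ι → ℝ≥0∞} (hA : ∀ i, IsClosed (A i))
    (hj : ∀ i, ∀ x ∈ A i, ∀ y ∈ A i, JoinedWithin D x y (ℓ i)) (hT : IsClosed T)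
    (hcov : T ⊆ ⋃ i, A i)
    {a b : X} (ha : a ∈ T) (hb : b ∈ T)
    (hsep : ∀ T₁ T₂ : Set X, IsClosed T₁ → IsClosed T₂ → Disjoint T₁ T₂ → T ⊆ T₁ ∪ T₂ →
      a ∈ T₁ → b ∈ T₂ → False) :
    JoinedWithin D a b (∑ i, ℓ i) := by
  classical
  -- The intersection graph of the family; along a path in it every member is used at most once.
  let G : SimpleGraph ι := SimpleGraph.fromRel fun i j => (A i ∩ A j).Nonempty
  obtain ⟨i₀, hi₀⟩ := mem_iUnion.1 (hcov ha)
  have hadj : ∀ i j, (A i ∩ A j).Nonempty → G.Reachable i j := by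
    intro i j h
    by_cases hij : i = j
    · subst hij; rfl
    · exact SimpleGraph.Adj.reachable ⟨hij, Or.inl h⟩
  have hwalk : ∀ (i j : ι) (p : G.Walk i j), ∀ x ∈ A i, ∀ y ∈ A j,
      JoinedWithin D x y (p.support.map ℓ).sum := by
    intro i j p
    induction p with
    | nil => intro x hx y hy; simpa using hj _ x hx y hy
    | @cons u v w h p ih =>
      intro x hx y hy
      obtain ⟨z, hz1, hz2⟩ : (A u ∩ A v).Nonempty := by
        rcases h.2 with h | h
        · exact h
        · rwa [inter_comm]
      simpa using (hj u x hx z hz1).trans (ih z hz2 y hy)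
  by_contra hno
  have hunreach : ∀ i, b ∈ A i → ¬ G.Reachable i₀ i := by
    intro i hi hr
    obtain ⟨p, hp⟩ := hr.exists_isPath
    refine hno ((hwalk _ _ p a hi₀ b hi).mono Subset.rfl ?_)
    rw [← List.sum_toFinset _ hp.support_nodup]
    exact Finset.sum_le_univ_sum_of_nonneg fun _ => zero_le
  refine hsep (T ∩ ⋃ i ∈ {i | G.Reachable i₀ i}, A i) (T ∩ ⋃ i ∈ {i | ¬ G.Reachable i₀ i}, A i)
    (hT.inter ((toFinite _).isClosed_biUnion fun i _ => hA i))
    (hT.inter ((toFinite _).isClosed_biUnion fun i _ => hA i)) ?_ ?_ ?_ ?_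
  · rw [Set.disjoint_left]
    rintro x ⟨-, hx1⟩ ⟨-, hx2⟩
    simp only [mem_iUnion, mem_ofPred_eq] at hx1 hx2
    obtain ⟨i, hi, hxi⟩ := hx1
    obtain ⟨j, hj', hxj⟩ := hx2
    exact hj' (hi.trans (hadj i j ⟨x, hxi, hxj⟩))
  · intro x hx
    obtain ⟨i, hi⟩ := mem_iUnion.1 (hcov hx)
    by_cases h : G.Reachable i₀ i
    · exact Or.inl ⟨hx, mem_biUnion (show i ∈ {i | G.Reachable i₀ i} from h) hi⟩
    · exact Or.inr ⟨hx, mem_biUnion (show i ∈ {i | ¬ G.Reachable i₀ i} from h) hi⟩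
  · exact ⟨ha, mem_biUnion (show i₀ ∈ {i | G.Reachable i₀ i} from SimpleGraph.Reachable.refl _) hi₀⟩
  · obtain ⟨i, hi⟩ := mem_iUnion.1 (hcov hb)
    exact ⟨hb, mem_biUnion (show i ∈ {i | ¬ G.Reachable i₀ i} from hunreach i hi) hi⟩

/-! ### Coverings, discs and components -/

theorem exists_cover_of_hausdorffMeasure_lt {X : Type*} [MetricSpace X] [MeasurableSpace X]
    [BorelSpace X] {d : ℝ} {E : Set X} {η r : ℝ≥0∞} (hη : μH[d] E < η) (hr : 0 < r) :
    ∃ t : ℕ → Set X, E ⊆ ⋃ n, t n ∧ (∀ n, Metric.ediam (t n) ≤ r) ∧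
      ∑' n, ⨆ _ : (t n).Nonempty, Metric.ediam (t n) ^ d < η := by
  rw [MeasureTheory.Measure.hausdorffMeasure_apply] at hη
  have h := (le_iSup₂ (f := fun (r : ℝ≥0∞) (_ : 0 < r) =>
    ⨅ (t : ℕ → Set X) (_ : E ⊆ ⋃ n, t n) (_ : ∀ n, Metric.ediam (t n) ≤ r),
      ∑' n, ⨆ _ : (t n).Nonempty, Metric.ediam (t n) ^ d) r hr).trans_lt hη
  simp only [iInf_lt_iff] at h
  obtain ⟨t, h1, h2, h3⟩ := h
  exact ⟨t, h1, h2, h3⟩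

/-- A compact set of small length is covered by finitely many small balls whose radii have a small
sum. -/
theorem IsCompact.exists_finset_ball_cover {X : Type*} [MetricSpace X] [Nonempty X]
    [MeasurableSpace X] [BorelSpace X] {K : Set X} (hK : IsCompact K) {η : ℝ≥0∞} (hη : μH[1] K < η) {r : ℝ}
    (hr : 0 < r) :
    ∃ (s : Finset ℕ) (c : ℕ → X) (ρ : ℕ → ℝ), (∀ i ∈ s, c i ∈ K ∧ 0 < ρ i ∧ ρ i < r) ∧
      K ⊆ ⋃ i ∈ s, Metric.ball (c i) (ρ i) ∧ ∑ i ∈ s, ENNReal.ofReal (ρ i) < η := by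
  classical
  obtain ⟨t, hKt, htd, hts⟩ :=
    exists_cover_of_hausdorffMeasure_lt hη (ENNReal.ofReal_pos.2 (half_pos hr))
  obtain ⟨δ, hδ0, hδ⟩ := ENNReal.exists_pos_sum_of_countable (tsub_pos_of_lt hts).ne' ℕ
  -- The summand `δ i` makes the radius positive where the covering set is a single point.
  set ρ : ℕ → ℝ := fun i => (Metric.ediam (t i)).toReal + min (δ i : ℝ) (r / 4) with hρ
  have hm0 : ∀ i, 0 < min (δ i : ℝ) (r / 4) := fun i => lt_min (hδ0 i) (by positivity)
  have hfin : ∀ i, Metric.ediam (t i) ≠ ∞ := fun i =>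
    ((htd i).trans_lt ENNReal.ofReal_lt_top).ne
  have hρ0 : ∀ i, 0 < ρ i := fun i => add_pos_of_nonneg_of_pos ENNReal.toReal_nonneg (hm0 i)
  have hρr : ∀ i, ρ i < r := fun i => by
    have h2 : (Metric.ediam (t i)).toReal ≤ r / 2 :=
      ENNReal.toReal_le_of_le_ofReal (by positivity) (htd i)
    have h3 := min_le_right (δ i : ℝ) (r / 4)
    simp only [hρ]; linarith
  set c : ℕ → X := fun i => if h : (t i ∩ K).Nonempty then h.choose else Classical.arbitrary X with hc
  have hct : ∀ i, (t i ∩ K).Nonempty → c i ∈ t i ∩ K := fun i h => by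
    simp only [hc, h, dif_pos]; exact h.choose_spec
  have hcov : K ⊆ ⋃ i : {i // (t i ∩ K).Nonempty}, Metric.ball (c i) (ρ i) := by
    intro x hx
    obtain ⟨i, hi⟩ := mem_iUnion.1 (hKt hx)
    have hne : (t i ∩ K).Nonempty := ⟨x, hi, hx⟩
    refine mem_iUnion.2 ⟨⟨i, hne⟩, ?_⟩
    have h4 : dist x (c i) ≤ (Metric.ediam (t i)).toReal := by
      rw [dist_edist]
      exact ENNReal.toReal_mono (hfin i) (Metric.edist_le_ediam_of_mem hi (hct i hne).1)
    have := hm0 i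
    simp only [Metric.mem_ball, hρ]
    linarith
  obtain ⟨s, hs⟩ := hK.elim_finite_subcover _ (fun _ => Metric.isOpen_ball) hcov
  refine ⟨s.map (Function.Embedding.subtype _), c, ρ, ?_, ?_, ?_⟩
  · intro i hi
    obtain ⟨⟨j, hj⟩, -, rfl⟩ := Finset.mem_map.1 hi
    exact ⟨(hct j hj).2, hρ0 j, hρr j⟩
  · intro x hx
    obtain ⟨i, hi, hxi⟩ := mem_iUnion₂.1 (hs hx)
    exact mem_iUnion₂.2 ⟨i, Finset.mem_map_of_mem _ hi, hxi⟩
  · rw [Finset.sum_map]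
    calc ∑ i ∈ s, ENNReal.ofReal (ρ (Function.Embedding.subtype _ i))
        ≤ ∑ i ∈ s, ((⨆ _ : (t i).Nonempty, Metric.ediam (t i) ^ (1 : ℝ)) + δ i) := by
          refine Finset.sum_le_sum fun i _ => ?_
          have hne : (t i).Nonempty := i.2.mono inter_subset_left
          simp only [hne, ciSup_pos, ENNReal.rpow_one, hρ, Function.Embedding.subtype_apply]
          rw [ENNReal.ofReal_add ENNReal.toReal_nonneg (hm0 i).le, ENNReal.ofReal_toReal (hfin i)]
          gcongr
          exact (ENNReal.ofReal_le_ofReal (min_le_left _ _)).trans (by simp)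
      _ ≤ ∑' i : ℕ, ((⨆ _ : (t i).Nonempty, Metric.ediam (t i) ^ (1 : ℝ)) + δ i) := by
          refine le_trans (le_of_eq ?_) (ENNReal.sum_le_tsum (s.map (Function.Embedding.subtype _)))
          rw [Finset.sum_map]; rfl
      _ < η := by
          rw [ENNReal.tsum_add]
          exact lt_tsub_iff_left.1 hδ

theorem hausdorffMeasure_one_sphere_le (c : ℂ) {r : ℝ} (hr : 0 ≤ r) :
    μH[1] (Metric.sphere c r) ≤ ENNReal.ofReal (2 * Real.pi) * ENNReal.ofReal r := by
  have h := (lipschitzWith_circleMap c r).lipschitzOnWith (s := Ioc 0 (2 * Real.pi))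
    |>.hausdorffMeasure_image_le (d := 1) zero_le_one
  rw [image_circleMap_Ioc, abs_of_nonneg hr] at h
  refine h.trans (le_of_eq ?_)
  rw [MeasureTheory.hausdorffMeasure_real, Real.volume_Ioc, sub_zero, mul_comm, ENNReal.rpow_one]
  congr 1
  rw [Real.nnabs_of_nonneg hr]; rfl

theorem frontier_biUnion_ball_subset {X ι : Type*} [MetricSpace X] (s : Finset ι) (c : ι → X)
    (ρ : ι → ℝ) :
    frontier (⋃ i ∈ s, Metric.ball (c i) (ρ i)) ⊆ ⋃ i ∈ s, Metric.sphere (c i) (ρ i) := by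
  intro x hx
  have ho : IsOpen (⋃ i ∈ s, Metric.ball (c i) (ρ i)) := isOpen_biUnion fun _ _ => Metric.isOpen_ball
  rw [ho.frontier_eq, s.closure_biUnion] at hx
  obtain ⟨i, hi, hxi⟩ := mem_iUnion₂.1 hx.1
  refine mem_iUnion₂.2 ⟨i, hi, le_antisymm (Metric.closure_ball_subset_closedBall hxi) ?_⟩
  by_contra! h
  exact hx.2 (mem_iUnion₂.2 ⟨i, hi, h⟩)

/-- In a closed totally disconnected set `E`, a compact part `Z` can be cut off from the rest of
`E` inside a bounded open neighbourhood `R`. -/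
theorem IsTotallyDisconnected.exists_isCompact_between {X : Type*} [MetricSpace X]
    {E C Z R : Set X} (hE : IsClosed E) (htd : IsTotallyDisconnected E) (hC : IsCompact C)
    (hZ : IsClosed Z) (hR : IsOpen R) (hRC : R ⊆ C) (hZE : Z ⊆ E) (hZR : Z ⊆ R) :
    ∃ K, IsCompact K ∧ Z ⊆ K ∧ K ⊆ E ∧ K ⊆ R ∧ IsClosed (E \ K) := by
  have hEC : IsCompact (E ∩ C) := hC.inter_left hE
  have : CompactSpace ↥(E ∩ C) := isCompact_iff_compactSpace.1 hEC
  have : TotallyDisconnectedSpace ↥(E ∩ C) :=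
    totallyDisconnectedSpace_subtype_iff.2
      fun t ht => htd t (ht.trans inter_subset_left)
  obtain ⟨V, hV, hZV, hVR⟩ := exists_clopen_of_closed_subset_open
    (Z := ((↑) : ↥(E ∩ C) → X) ⁻¹' Z) (U := ((↑) : ↥(E ∩ C) → X) ⁻¹' R)
    (hZ.preimage continuous_subtype_val) (hR.preimage continuous_subtype_val)
    (preimage_mono hZR)
  have hKE : ((↑) : ↥(E ∩ C) → X) '' V ⊆ E ∩ C := by rintro _ ⟨x, -, rfl⟩; exact x.2
  have hKR : ((↑) : ↥(E ∩ C) → X) '' V ⊆ R := image_subset_iff.2 hVR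
  refine ⟨(↑) '' V, hV.isClosed.isCompact.image continuous_subtype_val, ?_,
    fun x hx => (hKE hx).1, hKR, ?_⟩
  · intro x hx
    exact ⟨⟨x, hZE hx, hRC (hZR hx)⟩, hZV hx, rfl⟩
  · have : E \ ((↑) '' V) = ((↑) '' Vᶜ : Set X) ∪ E \ R := by
      ext x
      constructor
      · rintro ⟨hx, hxV⟩
        by_cases h : x ∈ R
        · exact Or.inl ⟨⟨x, hx, hRC h⟩, fun hv => hxV ⟨_, hv, rfl⟩, rfl⟩
        · exact Or.inr ⟨hx, h⟩
      · rintro (⟨y, hy, rfl⟩ | ⟨hx, h⟩)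
        · refine ⟨y.2.1, ?_⟩
          rintro ⟨z, hz, hzy⟩
          exact hy (Subtype.ext hzy ▸ hz)
        · exact ⟨hx, fun hv => h (hKR hv)⟩
    rw [this]
    exact (hV.compl.isClosed.isCompact.image continuous_subtype_val).isClosed.union
      (hE.sdiff hR)

theorem IsClosed.connectedComponentIn {X : Type*} [TopologicalSpace X] {F : Set X} {x : X}
    (hF : IsClosed F) : IsClosed (connectedComponentIn F x) := by
  by_cases hx : x ∈ F
  · refine isClosed_of_closure_subset ?_
    exact isPreconnected_connectedComponentIn.closure.subset_connectedComponentIn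
      (subset_closure (mem_connectedComponentIn hx))
      (closure_minimal (connectedComponentIn_subset _ _) hF)
  · rw [connectedComponentIn_eq_empty hx]; exact isClosed_empty

/-- The frontier of a component of the complement of `U` lies in the frontier of `U`. -/
theorem frontier_connectedComponentIn_compl_subset {U : Set ℂ} (hU : IsOpen U) (x : ℂ) :
    frontier (connectedComponentIn Uᶜ x) ⊆ frontier U := by
  intro y hy
  have hcl : IsClosed (connectedComponentIn Uᶜ x) := hU.isClosed_compl.connectedComponentIn
  have hyO := hcl.frontier_subset hy
  have hyU : y ∈ Uᶜ := connectedComponentIn_subset _ _ hyO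
  rw [hU.frontier_eq]
  refine ⟨?_, hyU⟩
  by_contra hno
  obtain ⟨r, hr, hb⟩ := Metric.isOpen_iff.1 isClosed_closure.isOpen_compl y hno
  have h1 : Metric.ball y r ⊆ connectedComponentIn Uᶜ y :=
    (convex_ball y r).isPreconnected.subset_connectedComponentIn (Metric.mem_ball_self hr)
      (hb.trans (compl_subset_compl.2 subset_closure))
  rw [connectedComponentIn_eq hyO] at hy
  exact hy.2 (mem_interior.2 ⟨_, h1, Metric.isOpen_ball, Metric.mem_ball_self hr⟩)

/-! ### The planar case: a segment that meets the set in a null set -/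

/-- A closed set that meets the segment from `0` to `L` in a null set for `μH[1]` is of small
length in a thin closed rectangle around that segment. -/
theorem exists_rectangle_hausdorffMeasure_lt {E : Set ℂ} (hE : IsClosed E) (hfin : μH[1] E < ∞)
    {L : ℝ} (h0 : μH[1] (E ∩ (fun t : ℝ => (t : ℂ)) '' Icc 0 L) = 0) {η : ℝ≥0∞} (hη : 0 < η) :
    ∃ δ : ℝ, 0 < δ ∧ μH[1] (E ∩ (Icc 0 L ×ℂ Icc (-δ) δ)) < η := by
  set F : ℕ → Set ℂ := fun k => E ∩ (Icc 0 L ×ℂ Icc (-(1 / ((k : ℝ) + 1))) (1 / ((k : ℝ) + 1)))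
    with hF
  have hclosed : ∀ k, IsClosed (F k) := fun k => hE.inter (isClosed_Icc.reProdIm isClosed_Icc)
  have hanti : Antitone F := by
    intro i j hij z hz
    refine ⟨hz.1, hz.2.1, ?_⟩
    have h1 := hz.2.2
    have : 1 / ((j : ℝ) + 1) ≤ 1 / ((i : ℝ) + 1) := Nat.one_div_le_one_div hij
    exact ⟨by linarith [h1.1], by linarith [h1.2]⟩
  have hlim := MeasureTheory.tendsto_measure_iInter_atTop (μ := μH[1]) (s := F)
    (fun k => (hclosed k).measurableSet.nullMeasurableSet) hanti
    ⟨0, ((MeasureTheory.measure_mono inter_subset_left).trans_lt hfin).ne⟩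
  have hzero : μH[1] (⋂ k, F k) = 0 := by
    refine MeasureTheory.measure_mono_null (fun z hz => ?_) h0
    rw [mem_iInter] at hz
    refine ⟨(hz 0).1, z.re, (hz 0).2.1, ?_⟩
    have h1 : |z.im| ≤ 0 := ge_of_tendsto' tendsto_one_div_add_atTop_nhds_zero_nat
      fun k => abs_le.2 (hz k).2.2
    have h2 : z.im = 0 := abs_eq_zero.1 (le_antisymm h1 (abs_nonneg _))
    exact Complex.ext rfl h2.symm
  rw [hzero] at hlim
  obtain ⟨k, hk⟩ := (hlim.eventually (gt_mem_nhds hη)).exists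
  exact ⟨1 / ((k : ℝ) + 1), Nat.one_div_pos_of_nat, hk⟩

/-- The complement of an open rectangle contains a connected set through the midpoints of two
opposite sides. -/
theorem exists_isPreconnected_around_rectangle (L δ : ℝ) :
    ∃ Q : Set ℂ, IsPreconnected Q ∧ (0 : ℂ) ∈ Q ∧ (L : ℂ) ∈ Q ∧
      Q ⊆ (Ioo 0 L ×ℂ Ioo (-δ) δ)ᶜ := by
  have hl : IsPreconnected {z : ℂ | z.re ≤ 0} := (convex_halfSpace_re_le 0).isPreconnected
  have hu : IsPreconnected {z : ℂ | δ ≤ z.im} := (convex_halfSpace_im_ge δ).isPreconnected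
  have hr : IsPreconnected {z : ℂ | L ≤ z.re} := (convex_halfSpace_re_ge L).isPreconnected
  refine ⟨{z : ℂ | z.re ≤ 0} ∪ {z : ℂ | δ ≤ z.im} ∪ {z : ℂ | L ≤ z.re},
    IsPreconnected.union ⟨L, δ⟩ (Or.inr (by simp)) (by simp)
      (IsPreconnected.union ⟨0, δ⟩ (by simp) (by simp) hl hu) hr, by simp, by simp, ?_⟩
  rintro z ((h | h) | h) hz
  · exact absurd hz.1.1 (not_lt.2 h)
  · exact absurd hz.2.2 (not_lt.2 h)
  · exact absurd hz.1.2 (not_lt.2 h)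

/-- A closed totally disconnected set in the plane that meets a segment in a set of length zero,
off the endpoints, can be avoided by a curve that is hardly longer than the segment. The
obstacle near the segment is enclosed in a finite union `U` of small discs with short boundary,
and the curve runs along the segment outside of `U` and along the outer boundary of `U`. -/
theorem joinedWithin_compl_of_segment_null {E : Set ℂ} (hE : IsClosed E)
    (htd : IsTotallyDisconnected E) (hfin : μH[1] E < ∞) {L : ℝ} (hL : 0 < L)
    (h0 : μH[1] (E ∩ (fun t : ℝ => (t : ℂ)) '' Icc 0 L) = 0) (h0E : (0 : ℂ) ∉ E)
    (hLE : (L : ℂ) ∉ E) {ε : ℝ} (hε : 0 < ε) :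
    JoinedWithin Eᶜ 0 (L : ℂ) (ENNReal.ofReal (L + ε)) := by
  classical
  set S : Set ℂ := (fun t : ℝ => (t : ℂ)) '' Icc 0 L with hSdef
  have hScomp : IsCompact S := isCompact_Icc.image Complex.continuous_ofReal
  have hSpre : IsPreconnected S := isPreconnected_Icc.image _ Complex.continuous_ofReal.continuousOn
  have h0S : (0 : ℂ) ∈ S := ⟨0, ⟨le_rfl, hL.le⟩, by simp⟩
  have hLS : (L : ℂ) ∈ S := ⟨L, ⟨hL.le, le_rfl⟩, rfl⟩
  have hpi : 0 < 2 * Real.pi := by positivity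
  set η : ℝ≥0∞ := ENNReal.ofReal (ε / 2 / (2 * Real.pi)) with hη
  have hη0 : 0 < η := ENNReal.ofReal_pos.2 (by positivity)
  obtain ⟨δ, hδ, hδη⟩ := exists_rectangle_hausdorffMeasure_lt hE hfin h0 hη0
  set R : Set ℂ := Ioo 0 L ×ℂ Ioo (-δ) δ with hR
  have hRo : IsOpen R := isOpen_Ioo.reProdIm isOpen_Ioo
  have hRC : R ⊆ Icc 0 L ×ℂ Icc (-δ) δ := fun z hz =>
    ⟨Ioo_subset_Icc_self hz.1, Ioo_subset_Icc_self hz.2⟩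
  -- the part of `E` that has to be bypassed
  obtain ⟨K, hK, hSK, hKE, hKR, hEK⟩ := htd.exists_isCompact_between hE
    (isCompact_Icc.reProdIm isCompact_Icc) (hE.inter hScomp.isClosed) hRo hRC inter_subset_left
    (by
      rintro _ ⟨hx, t, ht, rfl⟩
      refine ⟨⟨lt_of_le_of_ne ht.1 ?_, lt_of_le_of_ne ht.2 ?_⟩, by simpa using hδ⟩
      · rintro h; simp only [Complex.ofReal_re] at h; rw [← h] at hx; exact h0E (by simpa using hx)
      · rintro h; simp only [Complex.ofReal_re] at h; rw [h] at hx; exact hLE hx)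
  have hKη : μH[1] K < η := (MeasureTheory.measure_mono
    (subset_inter hKE (hKR.trans hRC))).trans_lt hδη
  obtain ⟨r, hr, hrR⟩ := hK.exists_cthickening_subset_open (hRo.inter hEK.isOpen_compl)
    (subset_inter hKR fun z hz h => h.2 hz)
  obtain ⟨s, c, ρ, hcρ, hKcov, hsum⟩ := hK.exists_finset_ball_cover hKη hr
  set U : Set ℂ := ⋃ i ∈ s, Metric.ball (c i) (ρ i) with hU
  have hUo : IsOpen U := isOpen_biUnion fun _ _ => Metric.isOpen_ball
  have hball : ∀ i ∈ s, Metric.closedBall (c i) (ρ i) ⊆ R ∩ (E \ K)ᶜ := fun i hi =>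
    (Metric.closedBall_subset_closedBall (hcρ i hi).2.2.le).trans
      ((Metric.closedBall_subset_cthickening (hcρ i hi).1 r).trans hrR)
  have hUR : U ⊆ R := iUnion₂_subset fun i hi =>
    Metric.ball_subset_closedBall.trans ((hball i hi).trans inter_subset_left)
  have hfrU : frontier U ⊆ ⋃ i ∈ s, Metric.sphere (c i) (ρ i) := frontier_biUnion_ball_subset s c ρ
  have hfrE : frontier U ⊆ Eᶜ := by
    intro z hz hzE
    obtain ⟨i, hi, hzi⟩ := mem_iUnion₂.1 (hfrU hz)
    have h1 := (hball i hi (Metric.sphere_subset_closedBall hzi)).2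
    have hzK : z ∈ K := by by_contra h; exact h1 ⟨hzE, h⟩
    rw [hUo.frontier_eq] at hz
    exact hz.2 (hKcov hzK)
  have hfrc : IsCompact (frontier U) :=
    ((s.finite_toSet.isCompact_biUnion fun i _ => isCompact_sphere (c i) (ρ i))).of_isClosed_subset
      isClosed_frontier hfrU
  have hfrη : μH[1] (frontier U) < ENNReal.ofReal (ε / 2) := by
    calc μH[1] (frontier U) ≤ ∑ i ∈ s, μH[1] (Metric.sphere (c i) (ρ i)) :=
          (MeasureTheory.measure_mono hfrU).trans (MeasureTheory.measure_biUnion_finset_le _ _)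
      _ ≤ ∑ i ∈ s, ENNReal.ofReal (2 * Real.pi) * ENNReal.ofReal (ρ i) :=
          Finset.sum_le_sum fun i hi => hausdorffMeasure_one_sphere_le _ (hcρ i hi).2.1.le
      _ = ENNReal.ofReal (2 * Real.pi) * ∑ i ∈ s, ENNReal.ofReal (ρ i) := by rw [Finset.mul_sum]
      _ < ENNReal.ofReal (2 * Real.pi) * η :=
          (ENNReal.mul_lt_mul_iff_right (ENNReal.ofReal_pos.2 hpi).ne' ENNReal.ofReal_ne_top).2 hsum
      _ = ENNReal.ofReal (ε / 2) := by
          rw [hη, ← ENNReal.ofReal_mul hpi.le, mul_div_cancel₀ _ hpi.ne']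
  -- the region outside of the obstacle
  obtain ⟨Q, hQ, h0Q, hLQ, hQR⟩ := exists_isPreconnected_around_rectangle L δ
  set O : Set ℂ := connectedComponentIn Uᶜ 0 with hO
  have hQO : Q ⊆ O := hQ.subset_connectedComponentIn h0Q
    (hQR.trans (compl_subset_compl.2 hUR))
  have hOc : IsClosed O := hUo.isClosed_compl.connectedComponentIn
  have hOU : O ⊆ Uᶜ := connectedComponentIn_subset _ _
  have hfrO : frontier O ⊆ frontier U := frontier_connectedComponentIn_compl_subset hUo 0
  -- discs along the boundary of the obstacle, so small that they avoid `E`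
  obtain ⟨r', hr', hrE'⟩ := hfrc.exists_cthickening_subset_open hE.isOpen_compl hfrE
  obtain ⟨s', c', ρ', hcρ', hcov', hsum'⟩ := hfrc.exists_finset_ball_cover hfrη hr'
  -- subdivision of the segment; a piece that is not contained in `U` is too short to reach `E`
  obtain ⟨r'', hr'', hrE''⟩ := (hScomp.diff hUo).exists_cthickening_subset_open
    hE.isOpen_compl (fun z hz hzE => hz.2 (hKcov (hSK ⟨hzE, hz.1⟩)))
  obtain ⟨N, hN⟩ := exists_nat_gt (L / r'')
  have hN0 : (0 : ℝ) < N := (div_pos hL hr'').trans hN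
  have hLN : L / N < r'' := by
    rw [div_lt_iff₀ hN0, mul_comm]; exact (div_lt_iff₀ hr'').1 hN
  set I : Fin N → Set ℂ := fun j =>
    (fun t : ℝ => (t : ℂ)) '' Icc (j * (L / N)) ((j + 1) * (L / N)) with hI
  have hIdist : ∀ j, ∀ x ∈ I j, ∀ y ∈ I j, dist x y ≤ L / N := by
    rintro j _ ⟨x, hx, rfl⟩ _ ⟨y, hy, rfl⟩
    rw [Complex.dist_eq, ← Complex.ofReal_sub, Complex.norm_real, Real.norm_eq_abs, abs_le]
    constructor <;> nlinarith [hx.1, hx.2, hy.1, hy.2]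
  have hIconv : ∀ j, Convex ℝ (I j) := fun j =>
    (convex_Icc _ _).linear_image Complex.ofRealCLM.toLinearMap
  let ι := {i // i ∈ s'} ⊕ {j : Fin N // (I j ∩ (S \ U)).Nonempty}
  let A : ι → Set ℂ := Sum.elim (fun i => Metric.closedBall (c' i) (ρ' i)) (fun j => I j)
  let ℓ : ι → ℝ≥0∞ :=
    Sum.elim (fun i => 2 * ENNReal.ofReal (ρ' i)) (fun _ => ENNReal.ofReal (L / N))
  have hcost : ∑ i, ℓ i ≤ ENNReal.ofReal (L + ε) := by
    rw [Fintype.sum_sum_type]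
    -- `ι` lists only the pieces of `S` that are needed; all `N` of them have total length `L`.
    have h1 : ∑ i : {i // i ∈ s'}, ℓ (Sum.inl i) ≤ ENNReal.ofReal ε := by
      simp only [ℓ, Sum.elim_inl]
      rw [← Finset.mul_sum, Finset.sum_coe_sort s' fun i => ENNReal.ofReal (ρ' i)]
      refine (mul_le_mul_right hsum'.le _).trans ?_
      rw [← ENNReal.ofReal_ofNat, ← ENNReal.ofReal_mul (by norm_num)]
      exact ENNReal.ofReal_le_ofReal (by linarith)
    have h2 : ∑ j : {j : Fin N // (I j ∩ (S \ U)).Nonempty}, ℓ (Sum.inr j) ≤ ENNReal.ofReal L := by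
      simp only [ℓ, Sum.elim_inr, Finset.sum_const, Finset.card_univ, nsmul_eq_mul]
      have h3 : Fintype.card {j : Fin N // (I j ∩ (S \ U)).Nonempty} ≤ N :=
        (Fintype.card_subtype_le _).trans (by simp)
      calc _ ≤ (N : ℝ≥0∞) * ENNReal.ofReal (L / N) := by gcongr
        _ = ENNReal.ofReal L := by
          rw [← ENNReal.ofReal_natCast, ← ENNReal.ofReal_mul hN0.le, mul_div_cancel₀ _ hN0.ne']
    rw [add_comm L ε, ENNReal.ofReal_add hε.le hL.le]
    exact add_le_add h1 h2
  refine (joinedWithin_of_finite_cover (A := A) (ℓ := ℓ) (T := frontier O ∪ S ∩ O) ?_ ?_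
    (isClosed_frontier.union (hScomp.isClosed.inter hOc)) ?_ (Or.inr ⟨h0S, hQO h0Q⟩)
    (Or.inr ⟨hLS, hQO hLQ⟩) ?_).mono Subset.rfl hcost
  · rintro (i | j)
    · exact Metric.isClosed_closedBall
    · exact (isCompact_Icc.image Complex.continuous_ofReal).isClosed
  · rintro (⟨i, hi⟩ | ⟨j, hj⟩) x hx y hy
    · refine ((convex_closedBall _ _).joinedWithin hx hy).mono ?_ ?_
      · exact (Metric.closedBall_subset_closedBall (hcρ' i hi).2.2.le).trans
          ((Metric.closedBall_subset_cthickening (hcρ' i hi).1 r').trans hrE')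
      · simp only [ℓ, Sum.elim_inl]
        rw [edist_dist, ← ENNReal.ofReal_ofNat, ← ENNReal.ofReal_mul (by norm_num)]
        refine ENNReal.ofReal_le_ofReal ((dist_triangle_right _ _ (c' i)).trans ?_)
        have h1 := Metric.mem_closedBall.1 hx
        have h2 := Metric.mem_closedBall.1 hy
        linarith
    · refine ((hIconv j).joinedWithin hx hy).mono ?_ ?_
      · obtain ⟨w, hwI, hwS⟩ := hj
        intro z hz
        exact hrE'' (Metric.closedBall_subset_cthickening hwS r''
          (Metric.mem_closedBall.2 ((hIdist j z hz w hwI).trans hLN.le)))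
      · simp only [ℓ, Sum.elim_inr]
        rw [edist_dist]
        exact ENNReal.ofReal_le_ofReal (hIdist j x hx y hy)
  · rintro z (hz | ⟨hzS, hzO⟩)
    · obtain ⟨i, hi, hzi⟩ := mem_iUnion₂.1 (hcov' (hfrO hz))
      exact mem_iUnion.2 ⟨Sum.inl ⟨i, hi⟩, Metric.ball_subset_closedBall hzi⟩
    · obtain ⟨t, ht, rfl⟩ := id hzS
      have hLN0 : 0 < L / N := div_pos hL hN0
      obtain ⟨j, hj⟩ : ∃ j : Fin N, t ∈ Icc (j * (L / N)) ((j + 1) * (L / N)) := by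
        rcases eq_or_lt_of_le ht.2 with h | h
        · have hNpos : 0 < N := by exact_mod_cast hN0
          refine ⟨⟨N - 1, by omega⟩, ?_⟩
          have h5 : N * (L / N) = L := mul_div_cancel₀ _ hN0.ne'
          rw [h]
          simp only [Nat.cast_sub (show 1 ≤ N by omega), Nat.cast_one, mem_Icc]
          constructor <;> nlinarith
        · have h6 : 0 ≤ t / (L / N) := div_nonneg ht.1 hLN0.le
          refine ⟨⟨⌊t / (L / N)⌋₊, ?_⟩, ?_, ?_⟩
          · rw [Nat.floor_lt h6, div_lt_iff₀ hLN0, mul_div_cancel₀ _ hN0.ne']; exact h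
          · exact (le_div_iff₀ hLN0).1 (Nat.floor_le h6)
          · exact ((div_lt_iff₀ hLN0).1 (Nat.lt_floor_add_one _)).le
      have hmem : (t : ℂ) ∈ I j := ⟨t, hj, rfl⟩
      exact mem_iUnion.2 ⟨Sum.inr ⟨j, ⟨t, hmem, hzS, hOU hzO⟩⟩, hmem⟩
  · intro T₁ T₂ h1 h2 hd hsub ha hb
    exact false_of_separated_frontier isPreconnected_connectedComponentIn hSpre h1 h2 hd
      (subset_union_left.trans hsub) (subset_union_right.trans hsub) h0S hLS (hQO h0Q) (hQO hLQ)
      ha hb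

/-! ### Slicing -/

/-- **Slicing inequality of Eilenberg**, qualitative form: if `E` has finite measure in dimension
`1 + m` and `f` is a contraction to a space whose measure `ν` has `m`-dimensional growth, then
almost all fibres of `f` on `E` have finite length. -/
theorem ae_hausdorffMeasure_one_fiber_lt_top {X Y : Type*} [MetricSpace X] [MeasurableSpace X]
    [BorelSpace X] [MetricSpace Y] [MeasurableSpace Y] [BorelSpace Y]
    (ν : MeasureTheory.Measure Y) {f : X → Y} (hf : LipschitzWith 1 f) {m : ℝ} (hm : 0 ≤ m)
    {C : ℝ≥0∞} (hC : C ≠ ∞)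
    (hν : ∀ A : Set Y, A.Nonempty → Metric.ediam A ≠ ∞ → ν A ≤ C * Metric.ediam A ^ m)
    {E : Set X} (hE : μH[1 + m] E < ∞) :
    ∀ᵐ y ∂ν, μH[1] (E ∩ f ⁻¹' {y}) < ∞ := by
  have hlt : μH[1 + m] E < μH[1 + m] E + 1 := ENNReal.lt_add_right hE.ne one_ne_zero
  set r : ℕ → ℝ≥0∞ := fun k => ((k : ℝ≥0∞) + 1)⁻¹ with hr
  have hrtop : ∀ k, r k ≠ ∞ := fun k => by simp [hr]
  have hr0 : ∀ k, 0 < r k := fun k => ENNReal.inv_pos.2 (by finiteness)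
  have hrt : Tendsto r atTop (𝓝 0) := by
    have := (tendsto_add_atTop_iff_nat 1).2 ENNReal.tendsto_inv_nat_nhds_zero
    simpa [hr] using this
  choose t ht1 ht2 ht3 using fun k => exists_cover_of_hausdorffMeasure_lt hlt (hr0 k)
  -- Closures make the images measurable without changing their diameters.
  set F : ℕ → Y → ℝ≥0∞ := fun k y =>
    ∑' i, (closure (f '' t k i)).indicator (fun _ => Metric.ediam (t k i)) y with hF
  have hFm : ∀ k, Measurable (F k) := fun k =>
    Measurable.tsum fun i => measurable_const.indicator isClosed_closure.measurableSet
  have hFint : ∀ k, ∫⁻ y, F k y ∂ν ≤ C * (μH[1 + m] E + 1) := by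
    intro k
    rw [MeasureTheory.lintegral_tsum fun i =>
      (measurable_const.indicator isClosed_closure.measurableSet).aemeasurable]
    calc _ ≤ ∑' i, C * (⨆ _ : (t k i).Nonempty, Metric.ediam (t k i) ^ (1 + m)) := by
          refine ENNReal.tsum_le_tsum fun i => ?_
          rw [MeasureTheory.lintegral_indicator_const isClosed_closure.measurableSet]
          rcases (t k i).eq_empty_or_nonempty with h | h
          · simp [h]
          · simp only [h, ciSup_pos]
            have hd : Metric.ediam (closure (f '' t k i)) ≤ Metric.ediam (t k i) := by
              rw [Metric.ediam_closure]
              simpa using hf.ediam_image_le (t k i)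
            have hdt : Metric.ediam (t k i) ≠ ∞ := ((ht2 k i).trans_lt (hrtop k).lt_top).ne
            calc _ ≤ Metric.ediam (t k i) * (C * Metric.ediam (t k i) ^ m) := by
                  gcongr
                  refine (hν _ (h.image f).closure (ne_top_of_le_ne_top hdt hd)).trans ?_
                  gcongr
              _ = C * Metric.ediam (t k i) ^ (1 + m) := by
                  rw [ENNReal.rpow_add_of_nonneg _ _ zero_le_one hm, ENNReal.rpow_one]; ring
      _ = C * ∑' i, (⨆ _ : (t k i).Nonempty, Metric.ediam (t k i) ^ (1 + m)) :=
          ENNReal.tsum_mul_left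
      _ ≤ _ := by gcongr; exact (ht3 k).le
  have hlim : ∫⁻ y, liminf (fun k => F k y) atTop ∂ν < ∞ := by
    refine (MeasureTheory.lintegral_liminf_le hFm).trans_lt
      (lt_of_le_of_lt ?_ (ENNReal.mul_lt_top hC.lt_top
        (ENNReal.add_lt_top.2 ⟨hE, ENNReal.one_lt_top⟩)))
    exact (liminf_le_liminf (Eventually.of_forall hFint)).trans_eq (liminf_const _)
  filter_upwards [MeasureTheory.ae_lt_top (Measurable.liminf hFm) hlim.ne] with y hy
  refine lt_of_le_of_lt ?_ hy
  refine (MeasureTheory.Measure.hausdorffMeasure_le_liminf_tsum 1 _ r hrt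
    (fun k i => t k i ∩ f ⁻¹' {y}) (Eventually.of_forall fun k i =>
      (Metric.ediam_mono inter_subset_left).trans (ht2 k i))
    (Eventually.of_forall fun k x hx => ?_)).trans ?_
  · obtain ⟨i, hi⟩ := mem_iUnion.1 (ht1 k hx.1)
    exact mem_iUnion.2 ⟨i, hi, hx.2⟩
  · refine liminf_le_liminf (Eventually.of_forall fun k => ENNReal.tsum_le_tsum fun i => ?_)
    rw [ENNReal.rpow_one]
    rcases (t k i ∩ f ⁻¹' {y}).eq_empty_or_nonempty with h | ⟨x, hx, hxy⟩
    · simp [h]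
    · have : y ∈ closure (f '' t k i) := subset_closure ⟨x, hx, hxy⟩
      rw [indicator_of_mem this]
      exact Metric.ediam_mono inter_subset_left

theorem volume_le_ediam_pow {V : Type*} [NormedAddCommGroup V] [InnerProductSpace ℝ V]
    [FiniteDimensional ℝ V] [MeasurableSpace V] [BorelSpace V] (A : Set V) (hA : A.Nonempty)
    (hd : Metric.ediam A ≠ ∞) :
    MeasureTheory.volume A ≤ MeasureTheory.volume (Metric.ball (0 : V) 1) *
      Metric.ediam A ^ (Module.finrank ℝ V : ℝ) := by
  obtain ⟨x, hx⟩ := hA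
  have h1 : A ⊆ Metric.closedBall x (Metric.ediam A).toReal := fun y hy => by
    rw [Metric.mem_closedBall, dist_edist]
    exact ENNReal.toReal_mono hd (Metric.edist_le_ediam_of_mem hy hx)
  refine (MeasureTheory.measure_mono h1).trans (le_of_eq ?_)
  rw [MeasureTheory.Measure.addHaar_closedBall _ _ ENNReal.toReal_nonneg, mul_comm,
    ENNReal.ofReal_pow ENNReal.toReal_nonneg, ENNReal.ofReal_toReal hd, ENNReal.rpow_natCast]

/-! ### Curves in the complement, and the endpoints -/

theorem JoinedWithin.map {X Y : Type*} [MetricSpace X] [MetricSpace Y] {D : Set X} {D' : Set Y}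
    {x y : X} {ℓ : ℝ≥0∞} (h : JoinedWithin D x y ℓ) {f : X → Y} (hf : Isometry f)
    (hD : MapsTo f D D') : JoinedWithin D' (f x) (f y) ℓ := by
  obtain ⟨α, β, γ, h1, h2, h3, h4, h5, h6⟩ := h
  refine ⟨α, β, f ∘ γ, h1, hf.continuous.comp_continuousOn h2, by simp [h3], by simp [h4],
    hD.comp h5, ?_⟩
  have := hf.lipschitz.lipschitzOnWith.comp_eVariationOn_le (mapsTo_univ γ (Icc α β))
  rw [ENNReal.coe_one, one_mul] at this
  exact this.trans h6

theorem IsTotallyDisconnected.preimage_of_injective {X Y : Type*} [TopologicalSpace X]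
    [TopologicalSpace Y] {E : Set Y} (hE : IsTotallyDisconnected E) {f : X → Y}
    (hf : Continuous f) (hi : Function.Injective f) : IsTotallyDisconnected (f ⁻¹' E) := by
  intro t ht hpre x hx y hy
  exact hi (hE (f '' t) (image_subset_iff.2 ht) (hpre.image f hf.continuousOn)
    (mem_image_of_mem f hx) (mem_image_of_mem f hy))

/-- The planar case for endpoints on the real axis and off `E`: all but countably many horizontal
lines meet `E` in a null set. -/
theorem joinedWithin_compl_complex {E : Set ℂ} (hE : IsClosed E)
    (htd : IsTotallyDisconnected E) (hfin : μH[1] E < ∞) {L : ℝ} (hL : 0 < L)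
    (h0E : (0 : ℂ) ∉ E) (hLE : (L : ℂ) ∉ E) {ε : ℝ} (hε : 0 < ε) :
    JoinedWithin Eᶜ 0 (L : ℂ) (ENNReal.ofReal (L + ε)) := by
  obtain ⟨r₀, hr₀, hb₀⟩ := Metric.isOpen_iff.1 hE.isOpen_compl 0 h0E
  obtain ⟨r₁, hr₁, hb₁⟩ := Metric.isOpen_iff.1 hE.isOpen_compl (L : ℂ) hLE
  set δ := min (min r₀ r₁) (ε / 4) with hδ
  have hδ0 : 0 < δ := by positivity
  have hδr₀ : δ ≤ r₀ := (min_le_left _ _).trans (min_le_left _ _)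
  have hδr₁ : δ ≤ r₁ := (min_le_left _ _).trans (min_le_right _ _)
  have hδε : δ ≤ ε / 4 := min_le_right _ _
  obtain ⟨t, htδ, htE⟩ : ∃ t ∈ Ioo 0 δ, μH[1] (E ∩ {z : ℂ | z.im = t}) = 0 := by
    have : MeasureTheory.IsFiniteMeasure ((μH[1] : MeasureTheory.Measure ℂ).restrict E) :=
      ⟨by simpa using hfin⟩
    have hcount := MeasureTheory.Measure.countable_meas_level_set_pos
      (μ := (μH[1] : MeasureTheory.Measure ℂ).restrict E) Complex.measurable_im
    have hnc : ¬ (Ioo 0 δ ⊆ {t : ℝ | 0 < (μH[1] : MeasureTheory.Measure ℂ).restrict E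
        {z : ℂ | z.im = t}}) := fun h => by
      have := (hcount.mono h).measure_zero MeasureTheory.volume
      simp [hδ0.not_ge] at this
    obtain ⟨t, ht, hpos⟩ := not_subset.1 hnc
    refine ⟨t, ht, ?_⟩
    simp only [mem_ofPred_eq, not_lt, nonpos_iff_eq_zero] at hpos
    have hmeas : MeasurableSet {z : ℂ | z.im = t} :=
      Complex.measurable_im (measurableSet_singleton t)
    rw [MeasureTheory.Measure.restrict_apply hmeas] at hpos
    rwa [inter_comm]
  set τ : ℂ → ℂ := fun z => z + t * Complex.I with hτ
  have hτi : Isometry τ := isometry_add_right _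
  have hdist : ∀ z : ℂ, dist (τ z) z = t := fun z => by
    simp [hτ, abs_of_pos htδ.1]
  have hmem₀ : τ 0 ∈ Metric.ball 0 r₀ := by
    rw [Metric.mem_ball, hdist]; linarith [htδ.2]
  have hmem₁ : τ L ∈ Metric.ball (L : ℂ) r₁ := by
    rw [Metric.mem_ball, hdist]; linarith [htδ.2]
  have hmid : JoinedWithin Eᶜ (τ 0) (τ L) (ENNReal.ofReal (L + ε / 2)) := by
    refine (joinedWithin_compl_of_segment_null (hE.preimage hτi.continuous)
      (htd.preimage_of_injective hτi.continuous hτi.injective) ?_ hL ?_ (hb₀ hmem₀) (hb₁ hmem₁)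
      (half_pos hε)).map hτi fun z hz => hz
    · rw [← hτi.hausdorffMeasure_image (Or.inl zero_le_one)]
      exact (MeasureTheory.measure_mono (image_preimage_subset _ _)).trans_lt hfin
    · rw [← hτi.hausdorffMeasure_image (Or.inl zero_le_one)]
      refine MeasureTheory.measure_mono_null ?_ htE
      rintro _ ⟨z, ⟨hz, s, -, rfl⟩, rfl⟩
      exact ⟨hz, by simp [hτ]⟩
  have hleft := ((convex_ball (0 : ℂ) r₀).joinedWithin (Metric.mem_ball_self hr₀) hmem₀).mono hb₀
    le_rfl
  have hright := ((convex_ball (L : ℂ) r₁).joinedWithin hmem₁ (Metric.mem_ball_self hr₁)).mono hb₁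
    le_rfl
  refine ((hleft.trans hmid).trans hright).mono Subset.rfl ?_
  rw [edist_dist, edist_dist, dist_comm, hdist, hdist, ← ENNReal.ofReal_add htδ.1.le (by linarith),
    ← ENNReal.ofReal_add (by linarith [htδ.1]) htδ.1.le]
  exact ENNReal.ofReal_le_ofReal (by linarith [htδ.2])

/-- In dimension at least two, every unit vector lies in an isometrically embedded copy of the
complex plane, as the image of `1`. -/
theorem exists_linearIsometry_complex {V : Type*} [NormedAddCommGroup V] [InnerProductSpace ℝ V]
    [FiniteDimensional ℝ V] (h2 : 2 ≤ Module.finrank ℝ V) {u : V} (hu : ‖u‖ = 1) :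
    ∃ J : ℂ →ₗᵢ[ℝ] V, J 1 = u := by
  set i₀ : Fin (Module.finrank ℝ V) := ⟨0, by omega⟩
  set i₁ : Fin (Module.finrank ℝ V) := ⟨1, by omega⟩
  have hi : i₀ ≠ i₁ := by simp [i₀, i₁]
  obtain ⟨b, hb⟩ := Orthonormal.exists_orthonormalBasis_extension_of_card_eq (𝕜 := ℝ) (E := V)
    (ι := Fin (Module.finrank ℝ V)) (by simp) (v := fun _ => u) (s := {i₀})
    (by
      constructor
      · intro i; exact hu
      · intro i j hij; exact absurd (Subsingleton.elim i j) hij)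
  have hbu : b i₀ = u := hb i₀ rfl
  set B := Complex.orthonormalBasisOneI with hB
  set f : ℂ →ₗ[ℝ] V := B.toBasis.constr ℝ ![b i₀, b i₁] with hf
  have hfB : f ∘ B.toBasis = b ∘ ![i₀, i₁] := by
    funext k
    simp only [Function.comp_apply, hf, Module.Basis.constr_basis]
    fin_cases k <;> rfl
  refine ⟨f.isometryOfOrthonormal (v := B.toBasis) (by simp) ?_, ?_⟩
  · rw [hfB]
    refine b.orthonormal.comp _ ?_
    intro k l hkl
    fin_cases k <;> fin_cases l <;> simp_all
  · have : B.toBasis 0 = (1 : ℂ) := by simp [hB]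
    have h0 : f (B.toBasis 0) = b i₀ := congrFun hfB 0
    rw [this, hbu] at h0
    exact h0

theorem IsTotallyDisconnected.exists_notMem_dist_lt {V : Type*} [NormedAddCommGroup V]
    [NormedSpace ℝ V] [Nontrivial V] {E : Set V} (htd : IsTotallyDisconnected E) (a : V) {r : ℝ} (hr : 0 < r) : ∃ p, p ∉ E ∧ dist p a < r := by
  by_contra! h
  have hb : Metric.ball a r ⊆ E := fun p hp => by
    by_contra hpE; exact absurd hp (not_lt.2 (h p hpE))
  obtain ⟨q, hq⟩ := (NormedSpace.sphere_nonempty (x := a)).2 (half_pos hr).le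
  have hqa : q = a := htd _ hb (convex_ball a r).isPreconnected
    (Metric.mem_ball.2 (by rw [Metric.mem_sphere.1 hq]; exact half_lt_self hr))
    (Metric.mem_ball_self hr)
  rw [hqa, Metric.mem_sphere, dist_self] at hq
  linarith

section

variable {V : Type*} [NormedAddCommGroup V] [InnerProductSpace ℝ V] [FiniteDimensional ℝ V]
  [MeasurableSpace V] [BorelSpace V] {E : Set V}

/-- Reduction to the planar case: among the planes parallel to `y - x` and close to `x` and `y`,
almost every one meets `E` in a set of finite length. -/
theorem joinedWithin_compl (h2 : 2 ≤ Module.finrank ℝ V) (hE : IsClosed E)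
    (htd : IsTotallyDisconnected E) (hfin : μH[(Module.finrank ℝ V : ℝ) - 1] E < ∞) {x y : V}
    (hx : x ∉ E) (hy : y ∉ E) {ε : ℝ} (hε : 0 < ε) :
    JoinedWithin Eᶜ x y (ENNReal.ofReal (dist x y + ε)) := by
  rcases eq_or_ne x y with rfl | hxy
  · exact JoinedWithin.refl hx
  obtain ⟨r₀, hr₀, hb₀⟩ := Metric.isOpen_iff.1 hE.isOpen_compl x hx
  obtain ⟨r₁, hr₁, hb₁⟩ := Metric.isOpen_iff.1 hE.isOpen_compl y hy
  set δ := min (min r₀ r₁) (ε / 4) with hδ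
  have hδ0 : 0 < δ := by positivity
  have hδr₀ : δ ≤ r₀ := (min_le_left _ _).trans (min_le_left _ _)
  have hδr₁ : δ ≤ r₁ := (min_le_left _ _).trans (min_le_right _ _)
  have hδε : δ ≤ ε / 4 := min_le_right _ _
  set L := ‖y - x‖ with hLdef
  have hL : 0 < L := norm_pos_iff.2 (sub_ne_zero.2 hxy.symm)
  obtain ⟨J, hJ⟩ := exists_linearIsometry_complex h2 (u := L⁻¹ • (y - x)) (by
    rw [norm_smul, norm_inv, norm_norm, inv_mul_cancel₀ hL.ne'])
  have hJL : J (L : ℂ) = y - x := by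
    have : (L : ℂ) = L • (1 : ℂ) := by simp
    rw [this, map_smul, hJ, smul_smul, mul_inv_cancel₀ hL.ne', one_smul]
  set W : Submodule ℝ V := LinearMap.range J.toLinearMap with hW
  have hWrank : Module.finrank ℝ W = 2 := by
    rw [hW, LinearMap.finrank_range_of_inj J.injective, Complex.finrank_real_complex]
  have hWo : Module.finrank ℝ Wᗮ + 2 = Module.finrank ℝ V := by
    rw [← W.finrank_add_finrank_orthogonal, hWrank, add_comm]
  set P := Wᗮ.orthogonalProjectionOnto with hP
  have hPJ : ∀ z, P (J z) = 0 := fun z => by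
    rw [hP, Submodule.orthogonalProjectionOnto_eq_zero_iff, Submodule.orthogonal_orthogonal]
    exact ⟨z, rfl⟩
  have hae := ae_hausdorffMeasure_one_fiber_lt_top (MeasureTheory.volume : MeasureTheory.Measure Wᗮ)
    (f := P) Wᗮ.lipschitzWith_orthogonalProjectionOnto (Nat.cast_nonneg (Module.finrank ℝ Wᗮ))
    (C := MeasureTheory.volume (Metric.ball (0 : Wᗮ) 1)) MeasureTheory.measure_ball_lt_top.ne
    volume_le_ediam_pow (E := E) (by
      have : (1 : ℝ) + (Module.finrank ℝ Wᗮ : ℝ) = (Module.finrank ℝ V : ℝ) - 1 := by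
        rw [← hWo]; push_cast; ring
      rwa [this])
  obtain ⟨w, hw, hwE⟩ : ∃ w ∈ Metric.ball (P x) δ, μH[1] (E ∩ P ⁻¹' {w}) < ∞ := by
    by_contra! hno
    have h0 : MeasureTheory.volume (Metric.ball (P x) δ) = 0 :=
      MeasureTheory.measure_mono_null (fun w hw => not_lt.2 (hno w hw))
        (MeasureTheory.ae_iff.1 hae)
    exact (Metric.measure_ball_pos _ _ hδ0).ne' h0
  set v : V := ((w - P x : Wᗮ) : V) with hv
  have hvδ : ‖v‖ < δ := by
    have h1 : ‖w - P x‖ < δ := by rw [← dist_eq_norm]; exact hw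
    exact h1
  have hPv : P v = w - P x := Submodule.orthogonalProjectionOnto_mem_subspace_eq_self _
  set τ : ℂ → V := fun z => (x + v) + J z with hτ
  have hτi : Isometry τ := (isometry_add_left (x + v)).comp J.isometry
  have hPτ : ∀ z, P (τ z) = w := fun z => by
    simp only [hτ, map_add, hPJ, hPv]; abel
  have hτ0 : τ 0 = x + v := by simp [hτ]
  have hτL : τ L = y + v := by simp only [hτ, hJL]; abel
  have hmem₀ : τ 0 ∈ Metric.ball x r₀ := by
    rw [hτ0, Metric.mem_ball, dist_self_add_left]; linarith
  have hmem₁ : τ L ∈ Metric.ball y r₁ := by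
    rw [hτL, Metric.mem_ball, dist_self_add_left]; linarith
  have hmid : JoinedWithin Eᶜ (τ 0) (τ L) (ENNReal.ofReal (L + ε / 2)) := by
    refine (joinedWithin_compl_complex (hE.preimage hτi.continuous)
      (htd.preimage_of_injective hτi.continuous hτi.injective) ?_ hL (hb₀ hmem₀) (hb₁ hmem₁)
      (half_pos hε)).map hτi fun z hz => hz
    rw [← hτi.hausdorffMeasure_image (Or.inl zero_le_one)]
    refine (MeasureTheory.measure_mono ?_).trans_lt hwE
    rintro _ ⟨z, hz, rfl⟩
    exact ⟨hz, hPτ z⟩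
  have hleft := ((convex_ball x r₀).joinedWithin (Metric.mem_ball_self hr₀) hmem₀).mono hb₀ le_rfl
  have hright := ((convex_ball y r₁).joinedWithin hmem₁ (Metric.mem_ball_self hr₁)).mono hb₁ le_rfl
  refine ((hleft.trans hmid).trans hright).mono Subset.rfl ?_
  rw [hτ0, hτL, edist_dist, edist_dist, dist_self_add_right, dist_self_add_left,
    ← ENNReal.ofReal_add (norm_nonneg _) (by positivity),
    ← ENNReal.ofReal_add (by positivity) (norm_nonneg _), dist_comm x y, dist_eq_norm]
  exact ENNReal.ofReal_le_ofReal (by linarith)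

/-- A point `y` off `E` is joined to an arbitrary point `a` through points off `E` that converge
to `a` at a geometric rate. -/
theorem joinedWithin_insert_compl (h2 : 2 ≤ Module.finrank ℝ V) (hE : IsClosed E)
    (htd : IsTotallyDisconnected E) (hfin : μH[(Module.finrank ℝ V : ℝ) - 1] E < ∞) {y : V}
    (hy : y ∉ E) (a : V) {ε : ℝ} (hε : 0 < ε) :
    JoinedWithin (insert a Eᶜ) y a (ENNReal.ofReal (dist y a + ε)) := by
  have : Nontrivial V := Module.nontrivial_of_finrank_pos (R := ℝ) (by omega)
  set η : ℕ → ℝ := fun k => ε / 6 * (1 / 2) ^ k with hη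
  have hη0 : ∀ k, 0 < η k := fun k => by positivity
  have hηs : ∀ k, η (k + 1) ≤ η k := fun k => by
    have := hη0 k
    have : η (k + 1) = η k / 2 := by simp only [hη, pow_succ]; ring
    linarith
  choose p hpE hpa using fun k => htd.exists_notMem_dist_lt a (hη0 k)
  set x : ℕ → V := fun k => if k = 0 then y else p k with hx
  have hxE : ∀ k, x k ∉ E := fun k => by
    simp only [hx]; split_ifs
    · exact hy
    · exact hpE k
  have hxa : ∀ k, dist (x k) a ≤ (if k = 0 then dist y a else 0) + η k := fun k => by
    simp only [hx]; split_ifs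
    · linarith [hη0 k]
    · linarith [hpa k]
  have hη1 : HasSum η (ε / 3) := by
    have := hasSum_geometric_two.mul_left (ε / 6)
    rwa [show ε / 6 * 2 = ε / 3 by ring] at this
  have hlim : Tendsto x atTop (𝓝 a) := by
    refine tendsto_iff_dist_tendsto_zero.2 (squeeze_zero' (Eventually.of_forall fun _ => dist_nonneg)
      ?_ hη1.summable.tendsto_atTop_zero)
    filter_upwards [eventually_ge_atTop 1] with k hk
    have := hxa k
    rwa [if_neg (by omega), zero_add] at this
  set ℓ : ℕ → ℝ≥0∞ := fun k =>
    (if k = 0 then ENNReal.ofReal (dist y a) else 0) + ENNReal.ofReal (3 * η k) with hℓ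
  have hsum : ∑' k, ℓ k = ENNReal.ofReal (dist y a + ε) := by
    have h3 := hη1.mul_left 3
    rw [ENNReal.tsum_add, tsum_ite_eq, ← ENNReal.ofReal_tsum_of_nonneg
      (fun k => by have := hη0 k; positivity) h3.summable, h3.tsum_eq,
      ← ENNReal.ofReal_add dist_nonneg (by positivity)]
    congr 1; ring
  have hstep : ∀ k, JoinedWithin (insert a Eᶜ) (x k) (x (k + 1)) (ℓ k) := fun k => by
    refine (joinedWithin_compl h2 hE htd hfin (hxE k) (hxE (k + 1)) (hη0 k)).mono
      (subset_insert _ _) ?_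
    have e1 := hxa k
    have e2 := hxa (k + 1)
    rw [if_neg (by omega), zero_add] at e2
    have e3 := dist_triangle_right (x k) (x (k + 1)) a
    have e4 : ℓ k = ENNReal.ofReal ((if k = 0 then dist y a else 0) + 3 * η k) := by
      rw [ENNReal.ofReal_add (by split_ifs <;> positivity) (by have := hη0 k; positivity)]
      simp only [hℓ]
      split_ifs <;> simp
    rw [e4]
    exact ENNReal.ofReal_le_ofReal (by linarith [hηs k])
  have := JoinedWithin.of_tendsto hlim (mem_insert _ _) (by rw [hsum]; exact ENNReal.ofReal_ne_top)
    hstep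
  rwa [hsum] at this

end

theorem theorem1p3 (n : ℕ) (hn : 2 ≤ n) (E : Set (EuclideanSpace ℝ (Fin n)))
    (hclosed : IsClosed E) (htd : IsTotallyDisconnected E)
    (hfin : μH[(n : ℝ) - 1] E < ∞) :
    MetricallyRemovable E := by
  intro ε hε a b
  have hrank : Module.finrank ℝ (EuclideanSpace ℝ (Fin n)) = n := by simp
  have h2 : 2 ≤ Module.finrank ℝ (EuclideanSpace ℝ (Fin n)) := by rwa [hrank]
  have hfin' : μH[(Module.finrank ℝ (EuclideanSpace ℝ (Fin n)) : ℝ) - 1] E < ∞ := by rwa [hrank]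
  have : Nontrivial (EuclideanSpace ℝ (Fin n)) :=
    Module.nontrivial_of_finrank_pos (R := ℝ) (by omega)
  have hε4 : 0 < ε / 4 := by positivity
  obtain ⟨y, hy, hya⟩ := htd.exists_notMem_dist_lt a hε4
  have h1 := (joinedWithin_insert_compl h2 hclosed htd hfin' hy a hε4).symm
  have h3 := joinedWithin_insert_compl h2 hclosed htd hfin' hy b hε4
  have hD : ∀ p ∈ ({a, b} : Set (EuclideanSpace ℝ (Fin n))), insert p Eᶜ ⊆ (E \ {a, b})ᶜ := by
    rintro p hp q (rfl | hq) hqE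
    · exact hqE.2 hp
    · exact hq hqE.1
  obtain ⟨α, β, γ, k1, k2, k3, k4, k5, k6⟩ :=
    (h1.mono (hD a (by simp)) le_rfl).trans (h3.mono (hD b (by simp)) le_rfl)
  refine ⟨α, β, γ, k1, k2, k3, k4, ?_, k6.trans ?_⟩
  · rw [Set.disjoint_left]
    rintro _ ⟨t, ht, rfl⟩
    exact k5 ht
  · rw [← ENNReal.ofReal_add (by positivity) (by positivity)]
    have := dist_triangle_left y b a
    rw [dist_comm a y] at this
    exact ENNReal.ofReal_le_ofReal (by linarith)
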